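/- Theorem 1 (Conditioning of the least squares for deconvolution). Let $N\ge 0$, $L\ge 1$ and $K\ge 0$ be integers and let $G\in\mathbb{R}^{N\times L}$. Write $\rho=\|G\|$ for the spectral norm of $G$, and $\theta_{\max}=\max_{1\le i\le L}\|Ge_i\|_2$ and $\theta_{\min}=\min_{1\le i\le L}\|Ge_i\|_2$ for its largest and smallest column norms, and assume $\theta_{\min}>0$. Let $\phi_1,\dots,\phi_K\in\{-1,1\}^L$ be random vectors all of whose $KL$ entries are independent and take the values $\pm1$ with probability $1/2$ each, let $D_{\phi_k}$ be the $L\times L$ diagonal matrix with diagonal $\phi_k$, and let $H\in\mathbb{R}^{KN\times L}$ be the matrix obtained by stacking the blocks $GD_{\phi_1},\dots,GD_{\phi_K}$ on top of each other. Let $\delta\in[0,1]$ and $\beta>0$, and suppose that $$K\ \ge\ \frac{\beta+1}{\log 4-1}\,\delta^{-2}\,\frac{\rho^2}{\theta_{\min}^2}\,\log L .$$ Then, with probability at least $1-2L^{-\beta}$, $$\mathrm{cond}(H^{\mathsf T}H)\ \le\ \frac{1+\delta}{1-\delta}\cdot\frac{\theta_{\max}^2}{\theta_{\min}^2}.$$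 Here $\mathrm{cond}(A)=\|A\|\,\|A^{-1}\|$ (spectral norms) is the condition number of a square matrix $A$, equal to $\infty$ if $A$ is singular; $\delta^{-2}$ is read as $\infty$ for $\delta=0$ (with $\infty\cdot 0=0$), and the right-hand side of the last inequality is read as $\infty$ for $\delta=1$. -/

import Mathlib

open MeasureTheory ProbabilityTheory
open scoped ENNReal Matrix Matrix.Norms.L2Operator

noncomputable section

namespace MaskedImaging

/-- The Euclidean norm of the `i`-th column `G eᵢ` of `G`. -/
def colNorm {N L : ℕ} (G : Matrix (Fin N) (Fin L) ℝ) (i : Fin L) : ℝ :=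
  ‖WithLp.toLp 2 (G *ᵥ (Pi.single i 1))‖

/-- The largest column norm of `G` (for `L ≥ 1`). -/
def thetaMax {N L : ℕ} (G : Matrix (Fin N) (Fin L) ℝ) : ℝ := ⨆ i, colNorm G i

/-- The smallest column norm of `G` (for `L ≥ 1`). -/
def thetaMin {N L : ℕ} (G : Matrix (Fin N) (Fin L) ℝ) : ℝ := ⨅ i, colNorm G i

/-- The spectral norm of `G`: its operator norm between Euclidean spaces. -/
def rho {N L : ℕ} (G : Matrix (Fin N) (Fin L) ℝ) : ℝ := ‖G‖

/-- The blocks `G D_{φ₁}, …, G D_{φ_K}`, stacked on top of each other; the row `(k, n)` is the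
`n`-th row of the `k`-th block. -/
def stacked {N L K : ℕ} (G : Matrix (Fin N) (Fin L) ℝ) (φ : Fin K → Fin L → ℝ) :
    Matrix (Fin K × Fin N) (Fin L) ℝ :=
  Matrix.of fun p l => (G * Matrix.diagonal (φ p.1)) p.2 l

open Classical in
/-- The (spectral) condition number `‖A‖ ‖A⁻¹‖` of a square matrix, infinite if `A` is
singular. -/
def condNumber {L : ℕ} (A : Matrix (Fin L) (Fin L) ℝ) : ℝ≥0∞ :=
  if IsUnit A then ENNReal.ofReal (‖A‖ * ‖A⁻¹‖) else ⊤

/-- The Rademacher distribution: `1` and `-1` with probability `1/2` each. -/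
def rademacher : Measure ℝ :=
  (2⁻¹ : ℝ≥0∞) • Measure.dirac (1 : ℝ) + (2⁻¹ : ℝ≥0∞) • Measure.dirac (-1 : ℝ)

end MaskedImaging

end

/-! `HᵀH` is a sum of `K` independent copies of `X = D_φ Gᵀ G D_φ`. Each copy is positive
semidefinite with `X² ≤ ρ² X`, and its mean is `diag(‖Geᵢ‖²)`, which lies between `θ_min²` and
`θ_max²`. A matrix Chernoff bound in each direction confines the spectrum to `[(1-δ)Kθ_min²,
(1+δ)Kθ_max²]`, except on two events of probability at most `L^(-β)` each; the ratio of the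
endpoints bounds the condition number.

The Chernoff bound avoids Golden–Thompson and Lieb. If `X² ≤ RX`, put `F(t) = tr exp(A+tX)`. Klein's
inequality identifies `F'(t) = tr(X exp(A+tX))`, and the mean value trace inequality gives `F'' ≤ R
F'`. Integrating yields `trace_exp_add_smul_le`, which is linear in `X` apart from the term `tr exp
A`; it can be averaged over one summand at a time.

Probability enters only at the end: the sign patterns are equally likely, so the tail bounds are
proved by counting patterns. -/

namespace MaskedImaging

/-! ### Spectral calculus and two-matrix trace inequalities. -/

section TraceExponential

variable {n : Type*} [Fintype n] [DecidableEq n]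

/-- The matrix `U f(diag a) Uᵀ`. -/
def spectralMap (U : Matrix n n ℝ) (a : n → ℝ) (f : ℝ → ℝ) : Matrix n n ℝ :=
  U * Matrix.diagonal (fun i => f (a i)) * Uᵀ

theorem exists_spectralMap_id_eq {A : Matrix n n ℝ} (hA : A.IsHermitian) :
    ∃ U : Matrix n n ℝ, Uᵀ * U = 1 ∧ U * Uᵀ = 1 ∧ A = spectralMap U hA.eigenvalues id := by
  refine ⟨hA.eigenvectorUnitary, ?_, ?_, ?_⟩
  · rw [← Matrix.conjTranspose_eq_transpose_of_trivial, ← Matrix.star_eq_conjTranspose]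
    exact Unitary.coe_star_mul_self _
  · rw [← Matrix.conjTranspose_eq_transpose_of_trivial, ← Matrix.star_eq_conjTranspose]
    exact Unitary.coe_mul_star_self _
  · conv_lhs => rw [hA.spectral_theorem, Unitary.conjStarAlgAut_apply]
    rw [Matrix.star_eq_conjTranspose, Matrix.conjTranspose_eq_transpose_of_trivial]
    rfl

theorem spectralMap_mul {U : Matrix n n ℝ} (hU : Uᵀ * U = 1) (a : n → ℝ) (f g : ℝ → ℝ) :
    spectralMap U a f * spectralMap U a g = spectralMap U a (fun x => f x * g x) := by
  have h : U * Matrix.diagonal (fun i => f (a i)) * Uᵀ *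
      (U * Matrix.diagonal (fun i => g (a i)) * Uᵀ) =
      U * Matrix.diagonal (fun i => f (a i)) * (Uᵀ * U) *
        Matrix.diagonal (fun i => g (a i)) * Uᵀ := by
    simp only [Matrix.mul_assoc]
  rw [spectralMap, spectralMap, spectralMap, h, hU, Matrix.mul_one, Matrix.mul_assoc U,
    Matrix.diagonal_mul_diagonal]

theorem spectralMap_const_one {U : Matrix n n ℝ} (hU : U * Uᵀ = 1) (a : n → ℝ) :
    spectralMap U a (fun _ => 1) = 1 := by
  simp [spectralMap, hU]

theorem exp_spectralMap {U : Matrix n n ℝ} (hU : Uᵀ * U = 1) (a : n → ℝ)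
    (f : ℝ → ℝ) :
    NormedSpace.exp (spectralMap U a f) = spectralMap U a (fun x => Real.exp (f x)) := by
  have hinv : U⁻¹ = Uᵀ := Matrix.inv_eq_left_inv hU
  have hunit : IsUnit U := (Matrix.isUnit_iff_isUnit_det U).2 (Matrix.isUnit_det_of_left_inverse hU)
  rw [spectralMap, ← hinv, Matrix.exp_conj _ _ hunit, hinv, Matrix.exp_diagonal, spectralMap]
  congr 3
  funext i
  rw [Pi.coe_exp, Real.exp_eq_exp_ℝ]

theorem trace_spectralMap {U : Matrix n n ℝ} (hU : Uᵀ * U = 1) (a : n → ℝ) (f : ℝ → ℝ) :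
    (spectralMap U a f).trace = ∑ i, f (a i) := by
  rw [spectralMap, Matrix.trace_mul_comm, ← Matrix.mul_assoc, hU, Matrix.one_mul,
    Matrix.trace_diagonal]

/-- The weights `(UᵀV)ᵢⱼ²` are nonnegative, so a trace inequality in two noncommuting symmetric
matrices follows from a scalar inequality for each pair of eigenvalues. -/
theorem trace_spectralMap_mul (U V : Matrix n n ℝ) (a b : n → ℝ) (f g : ℝ → ℝ) :
    (spectralMap U a f * spectralMap V b g).trace =
      ∑ i, ∑ j, f (a i) * g (b j) * (Uᵀ * V) i j ^ 2 := by
  have h : (spectralMap U a f * spectralMap V b g).trace =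
      ((Matrix.diagonal (fun i => f (a i)) * (Uᵀ * V)) *
        (Matrix.diagonal (fun i => g (b i)) * (Uᵀ * V)ᵀ)).trace := by
    rw [spectralMap, spectralMap, Matrix.mul_assoc U, Matrix.mul_assoc U, Matrix.trace_mul_comm,
      Matrix.transpose_mul, Matrix.transpose_transpose]
    simp only [Matrix.mul_assoc]
  rw [h, Matrix.trace]
  refine Finset.sum_congr rfl fun i _ => ?_
  rw [Matrix.diag_apply, Matrix.mul_apply]
  refine Finset.sum_congr rfl fun j _ => ?_
  rw [Matrix.diagonal_mul, Matrix.diagonal_mul, Matrix.transpose_apply]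
  ring

/-- Klein's inequality for the exponential function. -/
theorem trace_sub_mul_exp_le {A B : Matrix n n ℝ} (hA : A.IsHermitian) (hB : B.IsHermitian) :
    ((B - A) * NormedSpace.exp A).trace ≤
      (NormedSpace.exp B).trace - (NormedSpace.exp A).trace := by
  obtain ⟨U, hU, hU', hAU⟩ := exists_spectralMap_id_eq hA
  obtain ⟨V, hV, hV', hBV⟩ := exists_spectralMap_id_eq hB
  set a := hA.eigenvalues
  set b := hB.eigenvalues
  have heA := exp_spectralMap hU a id
  have heB := exp_spectralMap hV b id
  rw [← hAU] at heA
  rw [← hBV] at heB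
  have h1 : (B * NormedSpace.exp A).trace =
      ∑ i, ∑ j, Real.exp (a i) * b j * (Uᵀ * V) i j ^ 2 := by
    rw [Matrix.trace_mul_comm, heA]
    conv_lhs => rw [hBV, trace_spectralMap_mul]
    rfl
  have h2 : (A * NormedSpace.exp A).trace =
      ∑ i, ∑ j, a i * Real.exp (a i) * (Uᵀ * V) i j ^ 2 := by
    rw [heA]
    conv_lhs => rw [hAU, spectralMap_mul hU, ← Matrix.mul_one (spectralMap _ _ _),
      ← spectralMap_const_one hV' b, trace_spectralMap_mul]
    simp
  have h3 : (NormedSpace.exp A).trace = ∑ i, ∑ j, Real.exp (a i) * (Uᵀ * V) i j ^ 2 := by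
    rw [heA, ← Matrix.mul_one (spectralMap _ _ _), ← spectralMap_const_one hV' b,
      trace_spectralMap_mul]
    simp
  have h4 : (NormedSpace.exp B).trace = ∑ i, ∑ j, Real.exp (b j) * (Uᵀ * V) i j ^ 2 := by
    rw [heB, ← Matrix.one_mul (spectralMap _ _ _), ← spectralMap_const_one hU' a,
      trace_spectralMap_mul]
    simp
  rw [Matrix.sub_mul, Matrix.trace_sub, h1, h2, h3, h4]
  simp only [← Finset.sum_sub_distrib]
  refine Finset.sum_le_sum fun i _ => Finset.sum_le_sum fun j _ => ?_
  -- What remains is the tangent line inequality for the convex function `exp` at `a i`.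
  rw [← sub_mul, ← sub_mul]
  refine mul_le_mul_of_nonneg_right ?_ (sq_nonneg _)
  have h := Real.add_one_le_exp (b j - a i)
  have h' : Real.exp (b j) = Real.exp (a i) * Real.exp (b j - a i) := by
    rw [← Real.exp_add]; congr 1; ring
  rw [h']
  nlinarith [Real.exp_pos (a i)]

/-- The trapezoidal rule overestimates the integral of the convex function `exp` over `[0, d]`. -/
theorem two_mul_exp_sub_one_le {d : ℝ} (hd : 0 ≤ d) :
    2 * (Real.exp d - 1) ≤ d * (1 + Real.exp d) := by
  have hderiv : ∀ x : ℝ, HasDerivAt (fun x : ℝ => x * (1 + Real.exp x) - 2 * (Real.exp x - 1))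
      (1 * (1 + Real.exp x) + x * Real.exp x - 2 * Real.exp x) x := fun x =>
    ((hasDerivAt_id x).mul ((Real.hasDerivAt_exp x).const_add 1)).sub
      (((Real.hasDerivAt_exp x).sub_const 1).const_mul 2)
  have hmono : Monotone (fun x : ℝ => x * (1 + Real.exp x) - 2 * (Real.exp x - 1)) := by
    refine monotone_of_deriv_nonneg (fun x => (hderiv x).differentiableAt) fun x => ?_
    rw [(hderiv x).deriv]
    have h := Real.add_one_le_exp (-x)
    have h' : Real.exp x * Real.exp (-x) = 1 := by rw [← Real.exp_add]; simp
    nlinarith [Real.exp_pos x]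
  have := hmono hd
  simp only [Real.exp_zero] at this
  linarith

theorem two_mul_sub_mul_exp_sub_exp_le (a b : ℝ) :
    2 * ((b - a) * (Real.exp b - Real.exp a)) ≤ (b - a) ^ 2 * (Real.exp a + Real.exp b) := by
  wlog hab : a ≤ b generalizing a b
  · have := this b a (le_of_not_ge hab)
    linarith
  have h := two_mul_exp_sub_one_le (sub_nonneg.2 hab)
  have h' : Real.exp b = Real.exp a * Real.exp (b - a) := by
    rw [← Real.exp_add]; congr 1; ring
  have := mul_le_mul_of_nonneg_left h (mul_nonneg (sub_nonneg.2 hab) (Real.exp_pos a).le)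
  rw [h']
  linarith

/-- The mean value trace inequality for the exponential function. -/
theorem two_mul_trace_sub_mul_exp_sub_exp_le {A B : Matrix n n ℝ} (hA : A.IsHermitian)
    (hB : B.IsHermitian) :
    2 * ((B - A) * (NormedSpace.exp B - NormedSpace.exp A)).trace ≤
      ((B - A) * (B - A) * (NormedSpace.exp A + NormedSpace.exp B)).trace := by
  obtain ⟨U, hU, hU', hAU⟩ := exists_spectralMap_id_eq hA
  obtain ⟨V, hV, hV', hBV⟩ := exists_spectralMap_id_eq hB
  set a := hA.eigenvalues
  set b := hB.eigenvalues
  have heA := exp_spectralMap hU a id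
  have heB := exp_spectralMap hV b id
  rw [← hAU] at heA
  rw [← hBV] at heB
  have onlyA : ∀ f, (spectralMap U a f).trace = ∑ i, ∑ j, f (a i) * (Uᵀ * V) i j ^ 2 := fun f => by
    rw [← Matrix.mul_one (spectralMap _ _ _), ← spectralMap_const_one hV' b, trace_spectralMap_mul]
    simp
  have onlyB : ∀ f, (spectralMap V b f).trace = ∑ i, ∑ j, f (b j) * (Uᵀ * V) i j ^ 2 := fun f => by
    rw [← Matrix.one_mul (spectralMap _ _ _), ← spectralMap_const_one hU' a, trace_spectralMap_mul]
    simp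
  have h1 : ((B - A) * (NormedSpace.exp B - NormedSpace.exp A)).trace =
      (B * NormedSpace.exp B).trace - (NormedSpace.exp A * B).trace -
        (A * NormedSpace.exp B).trace + (A * NormedSpace.exp A).trace := by
    rw [Matrix.trace_mul_comm (NormedSpace.exp A) B, ← Matrix.trace_sub, ← Matrix.trace_sub,
      ← Matrix.trace_add]
    congr 1
    noncomm_ring
  have hcA : A * NormedSpace.exp A = NormedSpace.exp A * A := by
    rw [heA]
    conv_lhs => rw [hAU, spectralMap_mul hU]
    conv_rhs => rw [hAU, spectralMap_mul hU]
    simp only [mul_comm]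
  have hcB : B * NormedSpace.exp B = NormedSpace.exp B * B := by
    rw [heB]
    conv_lhs => rw [hBV, spectralMap_mul hV]
    conv_rhs => rw [hBV, spectralMap_mul hV]
    simp only [mul_comm]
  have h2 : ((B - A) * (B - A) * (NormedSpace.exp A + NormedSpace.exp B)).trace =
      (NormedSpace.exp A * (B * B)).trace - 2 * (A * NormedSpace.exp A * B).trace +
        (A * A * NormedSpace.exp A).trace + (B * B * NormedSpace.exp B).trace -
        2 * (A * (B * NormedSpace.exp B)).trace + (A * A * NormedSpace.exp B).trace := by
    have e1 : (B - A) * (B - A) * (NormedSpace.exp A + NormedSpace.exp B) =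
      B * B * NormedSpace.exp A - B * (A * NormedSpace.exp A) - A * B * NormedSpace.exp A +
        A * A * NormedSpace.exp A + B * B * NormedSpace.exp B - B * A * NormedSpace.exp B -
        A * (B * NormedSpace.exp B) + A * A * NormedSpace.exp B := by noncomm_ring
    have e2 : (B * B * NormedSpace.exp A).trace = (NormedSpace.exp A * (B * B)).trace :=
      Matrix.trace_mul_comm _ _
    have e3 : (B * (A * NormedSpace.exp A)).trace = (A * NormedSpace.exp A * B).trace :=
      Matrix.trace_mul_comm _ _
    have e4 : (A * B * NormedSpace.exp A).trace = (A * NormedSpace.exp A * B).trace := by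
      rw [Matrix.trace_mul_comm, ← Matrix.mul_assoc, hcA]
    have e5 : (B * A * NormedSpace.exp B).trace = (A * (B * NormedSpace.exp B)).trace := by
      rw [hcB, ← Matrix.mul_assoc, Matrix.trace_mul_comm (A * NormedSpace.exp B), Matrix.mul_assoc]
    simp only [e1, Matrix.trace_add, Matrix.trace_sub, e2, e3, e4, e5]
    ring
  have hAA : A * A = spectralMap U a fun x => x * x := by
    conv_lhs => rw [hAU, spectralMap_mul hU]
    rfl
  have hBB : B * B = spectralMap V b fun x => x * x := by
    conv_lhs => rw [hBV, spectralMap_mul hV]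
    rfl
  have hAe : A * NormedSpace.exp A = spectralMap U a fun x => x * Real.exp x := by
    rw [heA]
    conv_lhs => rw [hAU, spectralMap_mul hU]
    rfl
  have hBe : B * NormedSpace.exp B = spectralMap V b fun x => x * Real.exp x := by
    rw [heB]
    conv_lhs => rw [hBV, spectralMap_mul hV]
    rfl
  have t1 : (NormedSpace.exp A * B).trace =
      ∑ i, ∑ j, Real.exp (a i) * b j * (Uᵀ * V) i j ^ 2 := by
    rw [heA]; conv_lhs => rw [hBV, trace_spectralMap_mul]
    rfl
  have t2 : (A * NormedSpace.exp B).trace =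
      ∑ i, ∑ j, a i * Real.exp (b j) * (Uᵀ * V) i j ^ 2 := by
    rw [heB]; conv_lhs => rw [hAU, trace_spectralMap_mul]
    rfl
  have t3 : (A * NormedSpace.exp A * B).trace =
      ∑ i, ∑ j, a i * Real.exp (a i) * b j * (Uᵀ * V) i j ^ 2 := by
    rw [hAe]; conv_lhs => rw [hBV, trace_spectralMap_mul]
    rfl
  have t4 : (A * (B * NormedSpace.exp B)).trace =
      ∑ i, ∑ j, a i * (b j * Real.exp (b j)) * (Uᵀ * V) i j ^ 2 := by
    rw [hBe]; conv_lhs => rw [hAU, trace_spectralMap_mul]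
    rfl
  rw [h1, h2, t1, t2, t3, t4, hAe, hBe, hAA, hBB, heA, heB, spectralMap_mul hU, spectralMap_mul hV,
    trace_spectralMap_mul, trace_spectralMap_mul, onlyA, onlyA, onlyB, onlyB]
  simp only [Finset.mul_sum, ← Finset.sum_sub_distrib, ← Finset.sum_add_distrib, id]
  refine Finset.sum_le_sum fun i _ => Finset.sum_le_sum fun j _ => ?_
  have := mul_le_mul_of_nonneg_right (two_mul_sub_mul_exp_sub_exp_le (a i) (b j))
    (sq_nonneg ((Uᵀ * V) i j))
  linarith

end TraceExponential

end MaskedImaging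

namespace MaskedImaging

/-! ### A differential inequality for the trace exponential along a line. -/

section TraceExponentialBound

variable {n : Type*} [Fintype n] [DecidableEq n]

/-- With `H = exp(M/2)` symmetric and `exp M = H²`, the trace is that of the positive semidefinite
matrix `HYH`. -/
theorem trace_mul_exp_nonneg {Y M : Matrix n n ℝ} (hY : Y.PosSemidef) (hM : M.IsHermitian) :
    0 ≤ (Y * NormedSpace.exp M).trace := by
  set H := NormedSpace.exp ((2⁻¹ : ℝ) • M) with hHdef
  have hH : H.IsHermitian := Matrix.IsHermitian.exp (by
    rw [Matrix.IsHermitian, Matrix.conjTranspose_smul, hM.eq]; simp)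
  have hsq : NormedSpace.exp M = H * H := by
    rw [hHdef, ← Matrix.exp_add_of_commute _ _ (Commute.refl _), ← add_smul]
    norm_num
  have := (hY.conjTranspose_mul_mul_same H).trace_nonneg
  rwa [hH.eq, Matrix.mul_assoc, Matrix.trace_mul_comm, Matrix.mul_assoc, ← hsq] at this

theorem isHermitian_add_smul {m : Type*} {A X : Matrix m m ℝ} (hA : A.IsHermitian) (hX : X.IsHermitian)
    (t : ℝ) : (A + t • X).IsHermitian := by
  rw [Matrix.IsHermitian, Matrix.conjTranspose_add, Matrix.conjTranspose_smul, hA.eq, hX.eq]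
  simp

theorem differentiable_trace_mul_exp_add_smul (Y A X : Matrix n n ℝ) :
    Differentiable ℝ fun t : ℝ => (Y * NormedSpace.exp (A + t • X)).trace := by
  have h : Differentiable ℝ fun t : ℝ => Y * NormedSpace.exp (A + t • X) := by
    intro t
    have h1 : DifferentiableAt ℝ (NormedSpace.exp : Matrix n n ℝ → Matrix n n ℝ) (A + t • X) :=
      (NormedSpace.exp_analytic (𝕂 := ℝ) (A + t • X)).differentiableAt
    have h2 : DifferentiableAt ℝ (fun t : ℝ => A + t • X) t := by fun_prop
    exact (h1.comp t h2).const_mul Y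
  exact (LinearMap.toContinuousLinearMap (Matrix.traceLinearMap n ℝ ℝ)).differentiable.comp h

/-- The mean value trace inequality for two points of the line bounds the increment by traces
against `X²`, and `X² ≤ RX` replaces these by traces against `X`. -/
theorem trace_mul_exp_slope_le {A X : Matrix n n ℝ} {R : ℝ} (hA : A.IsHermitian)
    (hX : X.IsHermitian) (hR : (R • X - X * X).PosSemidef) {s t : ℝ} (hst : s < t) :
    slope (fun t : ℝ => (X * NormedSpace.exp (A + t • X)).trace) s t ≤
      R / 2 * ((X * NormedSpace.exp (A + s • X)).trace +
        (X * NormedSpace.exp (A + t • X)).trace) := by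
  have hs := isHermitian_add_smul hA hX s
  have ht := isHermitian_add_smul hA hX t
  have key := two_mul_trace_sub_mul_exp_sub_exp_le hs ht
  have hd : A + t • X - (A + s • X) = (t - s) • X := by rw [sub_smul]; abel
  have h1 := trace_mul_exp_nonneg hR hs
  have h2 := trace_mul_exp_nonneg hR ht
  rw [hd] at key
  simp only [Matrix.smul_mul, Matrix.mul_smul, Matrix.trace_smul, Matrix.mul_sub, Matrix.mul_add,
    Matrix.sub_mul, Matrix.trace_sub, Matrix.trace_add, smul_eq_mul] at key h1 h2
  have hpos := sub_pos.2 hst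
  rw [slope_def_field, div_le_iff₀ hpos]
  have h3 := mul_le_mul_of_nonneg_left h1 (mul_pos hpos hpos).le
  have h4 := mul_le_mul_of_nonneg_left h2 (mul_pos hpos hpos).le
  refine le_of_mul_le_mul_left ?_ (mul_pos hpos two_pos)
  linarith

theorem deriv_trace_mul_exp_le {A X : Matrix n n ℝ} {R : ℝ} (hA : A.IsHermitian)
    (hX : X.IsHermitian) (hR : (R • X - X * X).PosSemidef) (s : ℝ) :
    deriv (fun t : ℝ => (X * NormedSpace.exp (A + t • X)).trace) s ≤
      R * (X * NormedSpace.exp (A + s • X)).trace := by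
  have hdiff := differentiable_trace_mul_exp_add_smul X A X
  have h1 := (hasDerivWithinAt_iff_tendsto_slope' (Set.self_notMem_Ioi (a := s))).1
    (hdiff s).hasDerivAt.hasDerivWithinAt
  have h2 : Filter.Tendsto (fun t => R / 2 * ((X * NormedSpace.exp (A + s • X)).trace +
      (X * NormedSpace.exp (A + t • X)).trace)) (nhdsWithin s (Set.Ioi s))
      (nhds (R / 2 * ((X * NormedSpace.exp (A + s • X)).trace +
        (X * NormedSpace.exp (A + s • X)).trace))) :=
    ((tendsto_nhdsWithin_of_tendsto_nhds (hdiff.continuous.tendsto s)).const_add _).const_mul _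
  have h3 := le_of_tendsto_of_tendsto h1 h2
    (eventually_nhdsWithin_of_forall fun t ht => trace_mul_exp_slope_le hA hX hR ht)
  linarith

/-- Klein's inequality, used in both directions, squeezes the difference quotient. Differentiability
is already known, so right-hand slopes suffice. -/
theorem hasDerivAt_trace_exp_add_smul {A X : Matrix n n ℝ} (hA : A.IsHermitian)
    (hX : X.IsHermitian) (s : ℝ) :
    HasDerivAt (fun t : ℝ => (NormedSpace.exp (A + t • X)).trace)
      (X * NormedSpace.exp (A + s • X)).trace s := by
  have hdiff : Differentiable ℝ fun t : ℝ => (NormedSpace.exp (A + t • X)).trace := by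
    simpa using differentiable_trace_mul_exp_add_smul 1 A X
  have hklein : ∀ s t : ℝ, (t - s) * (X * NormedSpace.exp (A + s • X)).trace ≤
      (NormedSpace.exp (A + t • X)).trace - (NormedSpace.exp (A + s • X)).trace := fun s t => by
    have h := trace_sub_mul_exp_le (isHermitian_add_smul hA hX s) (isHermitian_add_smul hA hX t)
    have hd : A + t • X - (A + s • X) = (t - s) • X := by rw [sub_smul]; abel
    rwa [hd, Matrix.smul_mul, Matrix.trace_smul, smul_eq_mul] at h
  have hcont := (differentiable_trace_mul_exp_add_smul X A X).continuous
  have h1 := (hasDerivWithinAt_iff_tendsto_slope' (Set.self_notMem_Ioi (a := s))).1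
    (hdiff s).hasDerivAt.hasDerivWithinAt
  have h2 : Filter.Tendsto (slope (fun t : ℝ => (NormedSpace.exp (A + t • X)).trace) s)
      (nhdsWithin s (Set.Ioi s)) (nhds (X * NormedSpace.exp (A + s • X)).trace) := by
    refine tendsto_of_tendsto_of_tendsto_of_le_of_le' tendsto_const_nhds
      (tendsto_nhdsWithin_of_tendsto_nhds (hcont.tendsto s))
      (eventually_nhdsWithin_of_forall fun t ht => ?_)
      (eventually_nhdsWithin_of_forall fun t ht => ?_)
    · have hpos := sub_pos.2 (Set.mem_Ioi.1 ht)
      rw [slope_def_field, le_div_iff₀ hpos]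
      linarith [hklein s t]
    · have hpos := sub_pos.2 (Set.mem_Ioi.1 ht)
      rw [slope_def_field, div_le_iff₀ hpos]
      linarith [hklein t s]
  have h := (hdiff s).hasDerivAt
  rwa [tendsto_nhds_unique h1 h2] at h

/-- A substitute for the Golden–Thompson inequality, in the form needed for the matrix Chernoff
bound. -/
theorem trace_exp_add_smul_le {A X : Matrix n n ℝ} {R : ℝ} (hA : A.IsHermitian)
    (hX : X.IsHermitian) (hR0 : 0 < R) (hR : (R • X - X * X).PosSemidef) (θ : ℝ) :
    (NormedSpace.exp (A + θ • X)).trace ≤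
      (NormedSpace.exp A).trace + (Real.exp (R * θ) - 1) / R * (X * NormedSpace.exp A).trace := by
  set D : ℝ → ℝ := fun t => (X * NormedSpace.exp (A + t • X)).trace with hD
  set F : ℝ → ℝ := fun t => (NormedSpace.exp (A + t • X)).trace with hF
  have hDdiff : Differentiable ℝ D := differentiable_trace_mul_exp_add_smul X A X
  have hexp : ∀ c t : ℝ, HasDerivAt (fun t => Real.exp (c * t)) (Real.exp (c * t) * c) t :=
    fun c t => by simpa using ((hasDerivAt_id t).const_mul c).exp
  -- Grönwall: `D' ≤ R D`.
  have hanti : Antitone fun t => Real.exp (-R * t) * D t := by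
    have hderiv := fun t => (hexp (-R) t).mul (hDdiff t).hasDerivAt
    refine antitone_of_deriv_nonpos (fun t => (hderiv t).differentiableAt) fun t => ?_
    have := mul_le_mul_of_nonneg_left (deriv_trace_mul_exp_le hA hX hR t)
      (Real.exp_pos (-R * t)).le
    have e := (hderiv t).deriv
    rw [show (fun t => Real.exp (-R * t) * D t) = (fun t => Real.exp (-R * t)) * D from rfl, e]
    simp only [hD] at this ⊢
    linarith
  have hcancel : ∀ t, Real.exp (R * t) * (Real.exp (-R * t) * D t) = D t := fun t => by
    rw [← mul_assoc, ← Real.exp_add]; simp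
  set Q : ℝ → ℝ := fun t => F t - (Real.exp (R * t) - 1) / R * D 0 with hQ
  have hQderiv : ∀ t, HasDerivAt Q (D t - Real.exp (R * t) * D 0) t := fun t => by
    have h := (hasDerivAt_trace_exp_add_smul hA hX t).sub
      ((((hexp R t).sub_const 1).div_const R).mul_const (D 0))
    rwa [mul_div_cancel_right₀ _ hR0.ne'] at h
  have hQdiff : Differentiable ℝ Q := fun t => (hQderiv t).differentiableAt
  -- By `hanti`, `D t - exp(Rt) D 0` is nonpositive for `t > 0` and nonnegative for `t < 0`, so `Q`
  -- peaks at `0` and both signs of `θ` are covered.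
  have hmax : Q θ ≤ Q 0 := by
    rcases le_total 0 θ with h | h
    · refine antitoneOn_of_deriv_nonpos (convex_Ici (0 : ℝ)) hQdiff.continuous.continuousOn
        hQdiff.differentiableOn (fun t ht => ?_) Set.self_mem_Ici h h
      rw [interior_Ici] at ht
      rw [(hQderiv t).deriv]
      have := mul_le_mul_of_nonneg_left (hanti (le_of_lt (Set.mem_Ioi.1 ht)))
        (Real.exp_pos (R * t)).le
      simp only [hcancel, mul_zero, Real.exp_zero, one_mul] at this
      linarith
    · refine monotoneOn_of_deriv_nonneg (convex_Iic (0 : ℝ)) hQdiff.continuous.continuousOn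
        hQdiff.differentiableOn (fun t ht => ?_) h Set.self_mem_Iic h
      rw [interior_Iic] at ht
      rw [(hQderiv t).deriv]
      have := mul_le_mul_of_nonneg_left (hanti (le_of_lt (Set.mem_Iio.1 ht)))
        (Real.exp_pos (R * t)).le
      simp only [hcancel, mul_zero, Real.exp_zero, one_mul] at this
      linarith
  simp only [hQ, hF, hD, mul_zero, Real.exp_zero, sub_self, zero_div, zero_mul, sub_zero, zero_smul,
    add_zero] at hmax
  linarith

/-! ### Matrix Chernoff bound in counting form. -/

variable {α : Type*} [Fintype α]

theorem trace_mul_exp_mono {Y Z M : Matrix n n ℝ} (h : (Z - Y).PosSemidef)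
    (hM : M.IsHermitian) :
    (Y * NormedSpace.exp M).trace ≤ (Z * NormedSpace.exp M).trace := by
  have := trace_mul_exp_nonneg h hM
  rw [Matrix.sub_mul, Matrix.trace_sub] at this
  linarith

/-- The moment generating function bound behind the matrix Chernoff inequality, for sums of
independent copies of a matrix that is uniformly distributed on a finite family. -/
theorem sum_trace_exp_add_smul_sum_le {X : α → Matrix n n ℝ} {R θ c μ : ℝ}
    (hX : ∀ a, (X a).IsHermitian) (hR0 : 0 < R) (hR : ∀ a, (R • X a - X a * X a).PosSemidef)
    (hc : c = (Real.exp (R * θ) - 1) / R)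
    (hmean : ∀ M : Matrix n n ℝ, M.IsHermitian →
      c * ((∑ a, X a) * NormedSpace.exp M).trace ≤
        c * (Fintype.card α * μ * (NormedSpace.exp M).trace))
    (K : ℕ) {A : Matrix n n ℝ} (hA : A.IsHermitian) :
    ∑ ε : Fin K → α, (NormedSpace.exp (A + θ • ∑ k, X (ε k))).trace ≤
      (Fintype.card α * Real.exp (c * μ)) ^ K * (NormedSpace.exp A).trace := by
  induction K generalizing A with
  | zero => simp
  | succ K ih =>
    have hstep : ∑ a, (NormedSpace.exp (A + θ • X a)).trace ≤
        Fintype.card α * Real.exp (c * μ) * (NormedSpace.exp A).trace := by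
      calc ∑ a, (NormedSpace.exp (A + θ • X a)).trace
          ≤ ∑ a, ((NormedSpace.exp A).trace + c * (X a * NormedSpace.exp A).trace) :=
            Finset.sum_le_sum fun a _ => hc ▸ trace_exp_add_smul_le hA (hX a) hR0 (hR a) θ
        _ = Fintype.card α * (NormedSpace.exp A).trace +
              c * ((∑ a, X a) * NormedSpace.exp A).trace := by
            rw [Finset.sum_add_distrib, ← Finset.mul_sum, Finset.sum_mul, Matrix.trace_sum]
            simp
        _ ≤ Fintype.card α * (c * μ + 1) * (NormedSpace.exp A).trace := by linarith [hmean A hA]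
        _ ≤ _ := by
            have h0 : 0 ≤ (NormedSpace.exp A).trace := by
              simpa using trace_mul_exp_nonneg Matrix.PosSemidef.one hA
            gcongr
            exact Real.add_one_le_exp _
    -- The first draw is absorbed into `A`, which is why the induction runs over all Hermitian `A`.
    calc ∑ ε : Fin (K + 1) → α, (NormedSpace.exp (A + θ • ∑ k, X (ε k))).trace
        = ∑ a, ∑ ε : Fin K → α,
            (NormedSpace.exp (A + θ • X a + θ • ∑ k, X (ε k))).trace := by
          rw [← (Fin.consEquiv fun _ : Fin (K + 1) => α).sum_comp, Fintype.sum_prod_type]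
          refine Finset.sum_congr rfl fun a _ => Finset.sum_congr rfl fun ε _ => ?_
          rw [Fin.sum_univ_succ, smul_add, ← add_assoc]
          rfl
      _ ≤ ∑ a, (Fintype.card α * Real.exp (c * μ)) ^ K * (NormedSpace.exp (A + θ • X a)).trace :=
          Finset.sum_le_sum fun a _ => ih (isHermitian_add_smul hA (hX a) θ)
      _ ≤ (Fintype.card α * Real.exp (c * μ)) ^ K *
            (Fintype.card α * Real.exp (c * μ) * (NormedSpace.exp A).trace) := by
          rw [← Finset.mul_sum]
          exact mul_le_mul_of_nonneg_left hstep (by positivity)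
      _ = _ := by rw [pow_succ]; ring

theorem trace_exp_smul {S : Matrix n n ℝ} (hS : S.IsHermitian) (θ : ℝ) :
    (NormedSpace.exp (θ • S)).trace = ∑ i, Real.exp (θ * hS.eigenvalues i) := by
  obtain ⟨U, hU, -, hSU⟩ := exists_spectralMap_id_eq hS
  have h : θ • S = spectralMap U hS.eigenvalues fun x => θ * x := by
    conv_lhs => rw [hSU]
    rw [spectralMap, spectralMap, ← Matrix.smul_mul, ← Matrix.mul_smul, ← Matrix.diagonal_smul]
    rfl
  rw [h, exp_spectralMap hU, trace_spectralMap hU]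

/-- Markov's inequality for the trace exponential, which dominates the exponential of each
eigenvalue. The factors `x` and `log (1 + x)` in the hypotheses carry the sign, so `x > 0` gives the
upper tail and `x < 0` the lower one. -/
theorem card_mul_exp_le_of_eigenvalues {X : α → Matrix n n ℝ} {R x μ : ℝ}
    (hX : ∀ a, (X a).IsHermitian) (hR0 : 0 < R) (hR : ∀ a, (R • X a - X a * X a).PosSemidef)
    (hx : -1 < x)
    (hmean : ∀ M : Matrix n n ℝ, M.IsHermitian →
      x * ((∑ a, X a) * NormedSpace.exp M).trace ≤
        x * (Fintype.card α * μ * (NormedSpace.exp M).trace))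
    (K : ℕ) (hS : ∀ ε : Fin K → α, (∑ k, X (ε k)).IsHermitian) (B : Finset (Fin K → α))
    (hB : ∀ ε ∈ B, ∃ i, Real.log (1 + x) * ((1 + x) * (K * μ)) ≤
      Real.log (1 + x) * (hS ε).eigenvalues i) :
    (B.card : ℝ) ≤ (Fintype.card α : ℝ) ^ K * (Fintype.card n *
      Real.exp (-(K * μ / R * ((1 + x) * Real.log (1 + x) - x)))) := by
  -- For `μ > 0`, the minimiser of the Chernoff exponent `(exp(Rθ) - 1)μ/R - θ(1+x)μ`.
  set θ := Real.log (1 + x) / R with hθ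
  have hRθ : Real.exp (R * θ) = 1 + x := by
    rw [hθ, mul_div_cancel₀ _ hR0.ne', Real.exp_log (by linarith)]
  have hmgf := sum_trace_exp_add_smul_sum_le (θ := θ) (c := x / R) (μ := μ) hX hR0 hR
    (by rw [hRθ]; ring) (fun M hM => by
      have := div_le_div_of_nonneg_right (hmean M hM) hR0.le
      rwa [mul_div_right_comm, mul_div_right_comm] at this) K (Matrix.isHermitian_zero (n := n))
  simp only [zero_add, NormedSpace.exp_zero, Matrix.trace_one, trace_exp_smul (hS _)] at hmgf
  set τ := θ * ((1 + x) * (K * μ)) with hτ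
  have hmarkov : (B.card : ℝ) * Real.exp τ ≤
      ∑ ε : Fin K → α, ∑ i, Real.exp (θ * (hS ε).eigenvalues i) := by
    calc (B.card : ℝ) * Real.exp τ = ∑ _ε ∈ B, Real.exp τ := by simp
      _ ≤ ∑ ε ∈ B, ∑ i, Real.exp (θ * (hS ε).eigenvalues i) := by
          refine Finset.sum_le_sum fun ε hε => ?_
          obtain ⟨i, hi⟩ := hB ε hε
          refine le_trans (Real.exp_le_exp.2 ?_)
            (Finset.single_le_sum (f := fun i => Real.exp (θ * (hS ε).eigenvalues i))
              (fun _ _ => (Real.exp_pos _).le) (Finset.mem_univ i))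
          have := div_le_div_of_nonneg_right hi hR0.le
          rwa [mul_div_right_comm, mul_div_right_comm] at this
      _ ≤ _ := Finset.sum_le_univ_sum_of_nonneg fun ε =>
          Finset.sum_nonneg fun _ _ => (Real.exp_pos _).le
  have h := hmarkov.trans hmgf
  rw [← le_div_iff₀ (Real.exp_pos τ)] at h
  refine h.trans (le_of_eq ?_)
  rw [mul_pow, ← Real.exp_nat_mul, div_eq_mul_inv, ← Real.exp_neg]
  have he : -(K * μ / R * ((1 + x) * Real.log (1 + x) - x)) = K * (x / R * μ) + -τ := by
    rw [hτ, hθ]; ring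
  rw [he, Real.exp_add]
  ring

end TraceExponentialBound

end MaskedImaging

/-! ### Quadratic lower bound for the Chernoff rate function. -/

namespace MaskedImaging

theorem half_mul_sq_le_of_nonpos {x : ℝ} (hx : -1 < x) (hx0 : x ≤ 0) :
    x ^ 2 / 2 ≤ (1 + x) * Real.log (1 + x) - x := by
  have hderiv : ∀ y : ℝ, -1 < y →
      HasDerivAt (fun y : ℝ => (1 + y) * Real.log (1 + y) - y - y ^ 2 / 2)
        (Real.log (1 + y) - y) y := fun y hy => by
    have h0 : 1 + y ≠ 0 := by linarith
    have h1 : HasDerivAt (fun y : ℝ => 1 + y) 1 y := (hasDerivAt_id y).const_add 1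
    refine (((h1.mul (h1.log h0)).sub (hasDerivAt_id y)).sub
      (((hasDerivAt_id y).pow 2).div_const 2)).congr_deriv ?_
    rw [mul_one_div_cancel h0]
    norm_num
  have hanti : AntitoneOn (fun y : ℝ => (1 + y) * Real.log (1 + y) - y - y ^ 2 / 2)
      (Set.Icc x 0) := by
    refine antitoneOn_of_deriv_nonpos (convex_Icc x 0)
      (fun y hy => (hderiv y (by linarith [hy.1])).continuousAt.continuousWithinAt)
      (fun y hy => ?_) fun y hy => ?_
    all_goals rw [interior_Icc] at hy
    · exact (hderiv y (by linarith [hy.1])).differentiableAt.differentiableWithinAt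
    · rw [(hderiv y (by linarith [hy.1])).deriv]
      linarith [Real.log_le_sub_one_of_pos (show 0 < 1 + y by linarith [hy.1])]
  have := hanti (Set.left_mem_Icc.2 hx0) (Set.right_mem_Icc.2 hx0) hx0
  norm_num at this
  linarith

/-- By concavity of `log`, the quotient `log(1+y)/y` decreases. -/
theorem mul_log_one_add_le {y z : ℝ} (hy : 0 ≤ y) (hyz : y ≤ z) :
    y * Real.log (1 + z) ≤ z * Real.log (1 + y) := by
  rcases hy.eq_or_lt with rfl | hy
  · simp
  have hz := hy.trans_le hyz
  have h := strictConcaveOn_log_Ioi.concaveOn.2 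
    (show 1 + z ∈ Set.Ioi (0 : ℝ) from Set.mem_Ioi.2 (by linarith))
    (show (1 : ℝ) ∈ Set.Ioi (0 : ℝ) from Set.mem_Ioi.2 one_pos) (show 0 ≤ y / z by positivity)
    (show 0 ≤ 1 - y / z by linarith [(div_le_one hz).2 hyz]) (by ring)
  have e : y / z * (1 + z) + (1 - y / z) = 1 + y := by field_simp; ring
  simp only [smul_eq_mul, mul_one, Real.log_one, mul_zero, add_zero, e] at h
  rw [div_mul_eq_mul_div, div_le_iff₀ hz] at h
  linarith

/-- The constant makes the difference `f` of the two sides vanish at `1` as well as at `0`. Since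
`f'(y)/y = log(1+y)/y - 2c` decreases, `f` rises and then falls, hence is nonnegative between. -/
theorem log_four_sub_one_mul_sq_le_of_nonneg {x : ℝ} (hx0 : 0 ≤ x) (hx1 : x ≤ 1) :
    (Real.log 4 - 1) * x ^ 2 ≤ (1 + x) * Real.log (1 + x) - x := by
  set c := Real.log 4 - 1 with hc
  have hlog4 : Real.log 4 = 2 * Real.log 2 := by
    rw [show (4 : ℝ) = 2 ^ 2 by norm_num, Real.log_pow]; norm_num
  set f : ℝ → ℝ := fun y => (1 + y) * Real.log (1 + y) - y - c * y ^ 2 with hf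
  have hderiv : ∀ y : ℝ, 0 ≤ y → HasDerivAt f (Real.log (1 + y) - 2 * c * y) y := fun y hy => by
    have h0 : 1 + y ≠ 0 := by linarith
    have h1 : HasDerivAt (fun y : ℝ => 1 + y) 1 y := (hasDerivAt_id y).const_add 1
    refine (((h1.mul (h1.log h0)).sub (hasDerivAt_id y)).sub
      (((hasDerivAt_id y).pow 2).const_mul c)).congr_deriv ?_
    rw [mul_one_div_cancel h0]
    norm_num
    ring
  suffices h : 0 ≤ f x by simp only [hf] at h; linarith
  have hf0 : f 0 = 0 := by simp [hf]
  have hf1 : f 1 = 0 := by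
    simp only [hf, hc, hlog4]; norm_num
  rcases hx0.eq_or_lt with rfl | hxpos
  · exact hf0.ge
  -- If `f' x ≥ 0`, then `f` increases on `[0, x]`; otherwise it decreases on `[x, 1]`.
  rcases le_total 0 (Real.log (1 + x) - 2 * c * x) with hd | hd
  · rw [← hf0]
    refine monotoneOn_of_deriv_nonneg (convex_Icc 0 x)
      (fun y hy => (hderiv y hy.1).continuousAt.continuousWithinAt)
      (fun y hy => ?_) (fun y hy => ?_) (Set.left_mem_Icc.2 hx0) (Set.right_mem_Icc.2 hx0) hx0
    all_goals rw [interior_Icc] at hy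
    · exact (hderiv y hy.1.le).differentiableAt.differentiableWithinAt
    · rw [(hderiv y hy.1.le).deriv]
      have := mul_log_one_add_le hy.1.le hy.2.le
      have h2 := mul_nonneg hy.1.le hd
      refine nonneg_of_mul_nonneg_right ?_ hxpos
      linarith
  · rw [← hf1]
    refine antitoneOn_of_deriv_nonpos (convex_Icc x 1)
      (fun y hy => (hderiv y (hx0.trans hy.1)).continuousAt.continuousWithinAt)
      (fun y hy => ?_) (fun y hy => ?_) (Set.left_mem_Icc.2 hx1) (Set.right_mem_Icc.2 hx1) hx1
    all_goals rw [interior_Icc] at hy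
    · exact (hderiv y (hx0.trans hy.1.le)).differentiableAt.differentiableWithinAt
    · rw [(hderiv y (hx0.trans hy.1.le)).deriv]
      have := mul_log_one_add_le hx0 hy.1.le
      have h2 := mul_nonneg (hx0.trans hy.1.le) (neg_nonneg.2 hd)
      refine nonpos_of_mul_nonpos_right ?_ hxpos
      linarith

theorem log_four_sub_one_mul_sq_le {x : ℝ} (hx : -1 < x) (hx1 : x ≤ 1) :
    (Real.log 4 - 1) * x ^ 2 ≤ (1 + x) * Real.log (1 + x) - x := by
  rcases le_total 0 x with h | h
  · exact log_four_sub_one_mul_sq_le_of_nonneg h hx1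
  · have hlog4 : Real.log 4 = 2 * Real.log 2 := by
      rw [show (4 : ℝ) = 2 ^ 2 by norm_num, Real.log_pow]; norm_num
    have := half_mul_sq_le_of_nonpos hx h
    nlinarith [Real.log_two_lt_d9, sq_nonneg x]

theorem log_four_sub_one_pos : 0 < Real.log 4 - 1 := by
  have hlog4 : Real.log 4 = 2 * Real.log 2 := by
    rw [show (4 : ℝ) = 2 ^ 2 by norm_num, Real.log_pow]; norm_num
  linarith [Real.log_two_gt_d9]

end MaskedImaging

namespace MaskedImaging

/-! ### Gram matrices of the masked blocks and the two tail counts. -/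

section SignPatterns

variable {N L : ℕ}

/-- The vector of signs `±1` encoded by a Boolean vector. -/
def signVec (σ : Fin L → Bool) (l : Fin L) : ℝ := if σ l then 1 else -1

/-- The Gram matrix `D_σ Gᵀ G D_σ` of a masked block. -/
def blockGram (G : Matrix (Fin N) (Fin L) ℝ) (σ : Fin L → Bool) : Matrix (Fin L) (Fin L) ℝ :=
  (G * Matrix.diagonal (signVec σ))ᵀ * (G * Matrix.diagonal (signVec σ))

theorem stacked_transpose_mul_self {K : ℕ} (G : Matrix (Fin N) (Fin L) ℝ)
    (ε : Fin K → Fin L → Bool) :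
    (stacked G fun k => signVec (ε k))ᵀ * stacked G (fun k => signVec (ε k)) =
      ∑ k, blockGram G (ε k) := by
  ext i j
  simp only [Matrix.mul_apply, Matrix.sum_apply, blockGram, Matrix.transpose_apply, stacked,
    Matrix.of_apply, Fintype.sum_prod_type]

theorem signVec_mul_self (σ : Fin L → Bool) (l : Fin L) : signVec σ l * signVec σ l = 1 := by
  unfold signVec; split_ifs <;> norm_num

theorem blockGram_apply (G : Matrix (Fin N) (Fin L) ℝ) (σ : Fin L → Bool) (i j : Fin L) :
    blockGram G σ i j = signVec σ i * signVec σ j * (Gᵀ * G) i j := by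
  rw [blockGram, Matrix.transpose_mul, Matrix.diagonal_transpose, Matrix.mul_assoc,
    Matrix.diagonal_mul, ← Matrix.mul_assoc, Matrix.mul_diagonal]
  ring

theorem posSemidef_transpose_mul_self {m n : Type*} [Fintype m] [Finite n]
    (Y : Matrix m n ℝ) : (Yᵀ * Y).PosSemidef := by
  rw [← Matrix.conjTranspose_eq_transpose_of_trivial]
  exact Matrix.posSemidef_conjTranspose_mul_self Y

theorem blockGram_posSemidef (G : Matrix (Fin N) (Fin L) ℝ) (σ : Fin L → Bool) :
    (blockGram G σ).PosSemidef :=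
  posSemidef_transpose_mul_self _

theorem posSemidef_sq_norm_sub_mul_transpose (G : Matrix (Fin N) (Fin L) ℝ) :
    (‖G‖ ^ 2 • (1 : Matrix (Fin N) (Fin N) ℝ) - G * Gᵀ).PosSemidef := by
  refine Matrix.PosSemidef.of_dotProduct_mulVec_nonneg ?_ fun x => ?_
  · rw [Matrix.IsHermitian, Matrix.conjTranspose_eq_transpose_of_trivial]
    simp
  · have h := Matrix.l2_opNorm_mulVec Gᵀ (WithLp.toLp 2 x)
    have hG : ‖Gᵀ‖ = ‖G‖ := by
      rw [← Matrix.conjTranspose_eq_transpose_of_trivial, Matrix.l2_opNorm_conjTranspose]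
    rw [hG] at h
    have h2 := pow_le_pow_left₀ (norm_nonneg _) h 2
    rw [mul_pow, EuclideanSpace.real_norm_sq_eq, EuclideanSpace.real_norm_sq_eq] at h2
    have e1 : x ⬝ᵥ ((G * Gᵀ) *ᵥ x) = ∑ i, (Gᵀ *ᵥ x) i ^ 2 := by
      rw [← Matrix.mulVec_mulVec, Matrix.dotProduct_mulVec, ← Matrix.mulVec_transpose, dotProduct]
      simp only [sq]
    have e2 : x ⬝ᵥ x = ∑ i, x i ^ 2 := by simp only [dotProduct, sq]
    rw [star_trivial, Matrix.sub_mulVec, Matrix.smul_mulVec, Matrix.one_mulVec, dotProduct_sub,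
      dotProduct_smul, e1, e2, smul_eq_mul, sub_nonneg]
    exact h2

/-- With `Y = G D_σ`, signs square to one, so `YYᵀ = GGᵀ ≤ ‖G‖²`; conjugating by `Y` gives the
claim. This is `X² ≤ RX` with `R = ‖G‖²`. -/
theorem sq_norm_smul_blockGram_sub_sq_posSemidef (G : Matrix (Fin N) (Fin L) ℝ)
    (σ : Fin L → Bool) :
    (‖G‖ ^ 2 • blockGram G σ - blockGram G σ * blockGram G σ).PosSemidef := by
  set Y := G * Matrix.diagonal (signVec σ) with hY
  have hYY : Y * Yᵀ = G * Gᵀ := by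
    rw [hY, Matrix.transpose_mul, Matrix.diagonal_transpose, Matrix.mul_assoc,
      ← Matrix.mul_assoc (Matrix.diagonal _), Matrix.diagonal_mul_diagonal]
    simp only [signVec_mul_self, Matrix.diagonal_one, Matrix.one_mul]
  have h := (posSemidef_sq_norm_sub_mul_transpose G).conjTranspose_mul_mul_same Y
  rw [← hYY, Matrix.conjTranspose_eq_transpose_of_trivial] at h
  have e : Yᵀ * (‖G‖ ^ 2 • 1 - Y * Yᵀ) * Y = ‖G‖ ^ 2 • blockGram G σ -
      blockGram G σ * blockGram G σ := by
    rw [blockGram, ← hY, Matrix.mul_sub, Matrix.sub_mul, Matrix.mul_smul, Matrix.smul_mul,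
      Matrix.mul_one]
    simp only [Matrix.mul_assoc]
  rwa [e] at h

theorem colNorm_sq (G : Matrix (Fin N) (Fin L) ℝ) (i : Fin L) :
    colNorm G i ^ 2 = (Gᵀ * G) i i := by
  rw [colNorm, EuclideanSpace.real_norm_sq_eq, Matrix.mul_apply]
  simp [sq]

theorem sum_signVec_mul (i j : Fin L) :
    ∑ σ : Fin L → Bool, signVec σ i * signVec σ j = if i = j then 2 ^ L else 0 := by
  split_ifs with h
  · subst h
    simp [signVec_mul_self]
  -- Flipping the `i`-th sign negates every term, so the sum is its own negative.
  · have hinv : Function.Involutive fun σ : Fin L → Bool => Function.update σ i (!σ i) := fun σ => by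
      simp
    have := Equiv.sum_comp (Function.Involutive.toPerm _ hinv) fun σ => signVec σ i * signVec σ j
    have hflip : ∀ σ : Fin L → Bool, signVec (Function.Involutive.toPerm _ hinv σ) i *
        signVec (Function.Involutive.toPerm _ hinv σ) j = -(signVec σ i * signVec σ j) := fun σ => by
      simp only [signVec, Function.Involutive.coe_toPerm, Function.update_self,
        Function.update_of_ne (Ne.symm h)]
      cases σ i <;> cases σ j <;> simp
    simp only [hflip, Finset.sum_neg_distrib] at this
    linarith

theorem sum_blockGram (G : Matrix (Fin N) (Fin L) ℝ) :
    ∑ σ, blockGram G σ =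
      (2 : ℝ) ^ L • Matrix.diagonal fun i => colNorm G i ^ 2 := by
  ext i j
  rw [Matrix.sum_apply]
  simp only [blockGram_apply, ← Finset.sum_mul, sum_signVec_mul, Matrix.smul_apply,
    Matrix.diagonal_apply, smul_eq_mul]
  split_ifs with h
  · subst h; rw [colNorm_sq]
  · simp

theorem colNorm_le_thetaMax (G : Matrix (Fin N) (Fin L) ℝ) (i : Fin L) :
    colNorm G i ≤ thetaMax G :=
  le_ciSup (Set.finite_range _).bddAbove i

theorem thetaMin_le_colNorm (G : Matrix (Fin N) (Fin L) ℝ) (i : Fin L) :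
    thetaMin G ≤ colNorm G i :=
  ciInf_le (Set.finite_range _).bddBelow i

theorem trace_sum_blockGram_mul_exp (G : Matrix (Fin N) (Fin L) ℝ) (M : Matrix (Fin L) (Fin L) ℝ) :
    ((∑ σ, blockGram G σ) * NormedSpace.exp M).trace =
      2 ^ L * ((Matrix.diagonal fun i => colNorm G i ^ 2) * NormedSpace.exp M).trace := by
  rw [sum_blockGram, Matrix.smul_mul, Matrix.trace_smul, smul_eq_mul]

theorem trace_sum_blockGram_mul_exp_le (G : Matrix (Fin N) (Fin L) ℝ)
    {M : Matrix (Fin L) (Fin L) ℝ} (hM : M.IsHermitian) :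
    ((∑ σ, blockGram G σ) * NormedSpace.exp M).trace ≤
      2 ^ L * thetaMax G ^ 2 * (NormedSpace.exp M).trace := by
  have h : (thetaMax G ^ 2 • 1 - Matrix.diagonal fun i => colNorm G i ^ 2).PosSemidef := by
    rw [Matrix.smul_one_eq_diagonal, Matrix.diagonal_sub]
    exact Matrix.PosSemidef.diagonal fun i => sub_nonneg.2
      (pow_le_pow_left₀ (norm_nonneg _) (colNorm_le_thetaMax G i) 2)
  have := trace_mul_exp_mono h hM
  rw [Matrix.smul_mul, Matrix.one_mul, Matrix.trace_smul, smul_eq_mul] at this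
  rw [trace_sum_blockGram_mul_exp, mul_assoc]
  gcongr

theorem le_trace_sum_blockGram_mul_exp (G : Matrix (Fin N) (Fin L) ℝ) (hG : 0 ≤ thetaMin G)
    {M : Matrix (Fin L) (Fin L) ℝ} (hM : M.IsHermitian) :
    2 ^ L * thetaMin G ^ 2 * (NormedSpace.exp M).trace ≤
      ((∑ σ, blockGram G σ) * NormedSpace.exp M).trace := by
  have h : ((Matrix.diagonal fun i => colNorm G i ^ 2) - thetaMin G ^ 2 • 1).PosSemidef := by
    rw [Matrix.smul_one_eq_diagonal, Matrix.diagonal_sub]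
    exact Matrix.PosSemidef.diagonal fun i => sub_nonneg.2
      (pow_le_pow_left₀ hG (thetaMin_le_colNorm G i) 2)
  have := trace_mul_exp_mono h hM
  rw [Matrix.smul_mul, Matrix.one_mul, Matrix.trace_smul, smul_eq_mul] at this
  rw [trace_sum_blockGram_mul_exp, mul_assoc]
  gcongr

theorem isHermitian_sum_blockGram {K : ℕ} (G : Matrix (Fin N) (Fin L) ℝ)
    (ε : Fin K → Fin L → Bool) : (∑ k, blockGram G (ε k)).IsHermitian := by
  rw [Matrix.IsHermitian, Matrix.conjTranspose_sum]
  exact Finset.sum_congr rfl fun k _ => (blockGram_posSemidef G (ε k)).isHermitian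

theorem norm_pos_of_thetaMin_pos (hL : 1 ≤ L) {G : Matrix (Fin N) (Fin L) ℝ}
    (hG : 0 < thetaMin G) : 0 < ‖G‖ := by
  refine norm_pos_iff.2 fun h => ?_
  have := hG.trans_le (thetaMin_le_colNorm G ⟨0, hL⟩)
  rw [colNorm, h, Matrix.zero_mulVec] at this
  simp at this

theorem card_sign_patterns_upper (hL : 1 ≤ L) {G : Matrix (Fin N) (Fin L) ℝ}
    (hG : 0 < thetaMin G) {δ : ℝ} (hδ : δ ∈ Set.Ioo (0 : ℝ) 1) (K : ℕ)
    (B : Finset (Fin K → Fin L → Bool))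
    (hB : ∀ ε ∈ B, ∃ i, (1 + δ) * (K * thetaMax G ^ 2) ≤
      (isHermitian_sum_blockGram G ε).eigenvalues i) :
    (B.card : ℝ) ≤ ((2 : ℝ) ^ L) ^ K * (L *
      Real.exp (-(K * thetaMax G ^ 2 / ‖G‖ ^ 2 * ((Real.log 4 - 1) * δ ^ 2)))) := by
  have h := card_mul_exp_le_of_eigenvalues (x := δ) (μ := thetaMax G ^ 2)
    (fun σ => (blockGram_posSemidef G σ).isHermitian) (pow_pos (norm_pos_of_thetaMin_pos hL hG) 2)
    (sq_norm_smul_blockGram_sub_sq_posSemidef G) (by linarith [hδ.1])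
    (fun M hM => mul_le_mul_of_nonneg_left
      (by simpa using trace_sum_blockGram_mul_exp_le G hM) hδ.1.le)
    K (isHermitian_sum_blockGram G) B fun ε hε => (hB ε hε).imp fun i hi =>
      mul_le_mul_of_nonneg_left hi (Real.log_nonneg (by linarith [hδ.1]))
  have h' := log_four_sub_one_mul_sq_le (by linarith [hδ.1]) hδ.2.le
  simp only [Fintype.card_pi, Fintype.card_bool, Finset.prod_const, Finset.card_univ,
    Fintype.card_fin, Nat.cast_pow, Nat.cast_ofNat] at h
  refine h.trans ?_
  gcongr

theorem card_sign_patterns_lower (hL : 1 ≤ L) {G : Matrix (Fin N) (Fin L) ℝ}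
    (hG : 0 < thetaMin G) {δ : ℝ} (hδ : δ ∈ Set.Ioo (0 : ℝ) 1) (K : ℕ)
    (B : Finset (Fin K → Fin L → Bool))
    (hB : ∀ ε ∈ B, ∃ i, (isHermitian_sum_blockGram G ε).eigenvalues i ≤
      (1 - δ) * (K * thetaMin G ^ 2)) :
    (B.card : ℝ) ≤ ((2 : ℝ) ^ L) ^ K * (L *
      Real.exp (-(K * thetaMin G ^ 2 / ‖G‖ ^ 2 * ((Real.log 4 - 1) * δ ^ 2)))) := by
  have h := card_mul_exp_le_of_eigenvalues (x := -δ) (μ := thetaMin G ^ 2)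
    (fun σ => (blockGram_posSemidef G σ).isHermitian) (pow_pos (norm_pos_of_thetaMin_pos hL hG) 2)
    (sq_norm_smul_blockGram_sub_sq_posSemidef G) (by linarith [hδ.2])
    (fun M hM => mul_le_mul_of_nonpos_left
      (by simpa using le_trace_sum_blockGram_mul_exp G hG.le hM) (by linarith [hδ.1]))
    -- Here `log(1-δ) ≤ 0` reverses the eigenvalue inequality.
    K (isHermitian_sum_blockGram G) B fun ε hε => (hB ε hε).imp fun i hi =>
      mul_le_mul_of_nonpos_left (by rwa [← sub_eq_add_neg])
        (Real.log_nonpos (by linarith [hδ.2]) (by linarith [hδ.1]))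
  have h' := log_four_sub_one_mul_sq_le (x := -δ) (by linarith [hδ.2]) (by linarith [hδ.1])
  rw [neg_sq] at h'
  simp only [Fintype.card_pi, Fintype.card_bool, Finset.prod_const, Finset.card_univ,
    Fintype.card_fin, Nat.cast_pow, Nat.cast_ofNat] at h
  refine h.trans ?_
  gcongr

end SignPatterns

/-! ### From eigenvalue bounds to the condition number. -/

section ConditionNumber

variable {n : Type*} [Fintype n] [DecidableEq n]

theorem norm_spectralMap_le {U : Matrix n n ℝ} (hU : Uᵀ * U = 1) (hU' : U * Uᵀ = 1) (a : n → ℝ)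
    (f : ℝ → ℝ) {C : ℝ} (hC : 0 ≤ C) (h : ∀ i, |f (a i)| ≤ C) : ‖spectralMap U a f‖ ≤ C := by
  have hmem : U ∈ unitary (Matrix n n ℝ) := by
    rw [Unitary.mem_iff, Matrix.star_eq_conjTranspose,
      Matrix.conjTranspose_eq_transpose_of_trivial]
    exact ⟨hU, hU'⟩
  have hmem' : Uᵀ ∈ unitary (Matrix n n ℝ) := by
    rw [← Matrix.conjTranspose_eq_transpose_of_trivial, ← Matrix.star_eq_conjTranspose]
    exact Unitary.star_mem hmem
  rw [spectralMap, CStarRing.norm_mul_mem_unitary _ hmem', CStarRing.norm_mem_unitary_mul _ hmem,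
    Matrix.l2_opNorm_diagonal]
  exact (pi_norm_le_iff_of_nonneg hC).2 h

theorem condNumber_le_of_eigenvalues {L : ℕ} {S : Matrix (Fin L) (Fin L) ℝ} (hS : S.IsHermitian)
    {m M : ℝ} (hm : 0 < m) (hM : 0 ≤ M) (h : ∀ i, hS.eigenvalues i ∈ Set.Icc m M) :
    condNumber S ≤ ENNReal.ofReal (M / m) := by
  obtain ⟨U, hU, hU', hSU⟩ := exists_spectralMap_id_eq hS
  set a := hS.eigenvalues
  have hinv : S * spectralMap U a (fun x => x⁻¹) = 1 := by
    conv_lhs => rw [hSU, spectralMap_mul hU]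
    rw [← spectralMap_const_one hU' a, spectralMap, spectralMap]
    congr 3
    funext i
    exact mul_inv_cancel₀ (hm.trans_le (h i).1).ne'
  have hunit : IsUnit S :=
    (Matrix.isUnit_iff_isUnit_det S).2 (Matrix.isUnit_det_of_right_inverse hinv)
  rw [condNumber, if_pos hunit, Matrix.inv_eq_right_inv hinv, div_eq_mul_inv]
  have h1 : ‖S‖ ≤ M := by
    conv_lhs => rw [hSU]
    refine norm_spectralMap_le hU hU' _ _ hM fun i => ?_
    rw [id, abs_of_nonneg (hm.le.trans (h i).1)]
    exact (h i).2
  have h2 : ‖spectralMap U a (fun x => x⁻¹)‖ ≤ m⁻¹ := by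
    refine norm_spectralMap_le hU hU' _ _ (inv_nonneg.2 hm.le) fun i => ?_
    rw [abs_of_nonneg (inv_nonneg.2 (hm.le.trans (h i).1))]
    exact inv_anti₀ hm (h i).1
  exact ENNReal.ofReal_le_ofReal (mul_le_mul h1 h2 (norm_nonneg _) hM)

end ConditionNumber

end MaskedImaging

namespace MaskedImaging

/-! ### From counting sign patterns to probabilities. -/

section Probability

variable {Ω : Type*} [MeasurableSpace Ω] {P : Measure Ω}

theorem measure_eq_of_hasLaw_rademacher {X : Ω → ℝ} (hX : HasLaw X rademacher P) (b : Bool) :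
    P (X ⁻¹' {if b then 1 else -1}) = 2⁻¹ := by
  rw [← Measure.map_apply_of_aemeasurable hX.aemeasurable (measurableSet_singleton _), hX.map_eq,
    rademacher]
  cases b <;> norm_num [Set.indicator]

theorem ae_eq_one_or_neg_one_of_hasLaw_rademacher {X : Ω → ℝ} (hX : HasLaw X rademacher P) :
    ∀ᵐ ω ∂P, X ω = 1 ∨ X ω = -1 := by
  have h : P (X ⁻¹' {1, -1}ᶜ) = 0 := by
    rw [← Measure.map_apply_of_aemeasurable hX.aemeasurable
      ((Set.toFinite _).measurableSet.compl), hX.map_eq, rademacher]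
    simp [Set.indicator]
  refine measure_mono_null (fun ω hω => ?_) h
  simpa using hω

variable {K L : ℕ} {φ : Fin K → Ω → Fin L → ℝ}

theorem ae_exists_eq_signVec (hφ_law : ∀ k l, HasLaw (fun ω => φ k ω l) rademacher P) :
    ∀ᵐ ω ∂P, ∃ ε : Fin K → Fin L → Bool, (fun k => φ k ω) = fun k => signVec (ε k) := by
  have h : ∀ᵐ ω ∂P, ∀ k l, φ k ω l = 1 ∨ φ k ω l = -1 :=
    ae_all_iff.2 fun k => ae_all_iff.2 fun l =>
      ae_eq_one_or_neg_one_of_hasLaw_rademacher (hφ_law k l)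
  filter_upwards [h] with ω hω
  refine ⟨fun k l => decide (φ k ω l = 1), ?_⟩
  funext k l
  rcases hω k l with h | h <;> simp [signVec, h]

theorem measure_eq_signVec [IsProbabilityMeasure P]
    (hφ_law : ∀ k l, HasLaw (fun ω => φ k ω l) rademacher P)
    (hφ_indep : iIndepFun (fun (p : Fin K × Fin L) ω => φ p.1 ω p.2) P)
    (ε : Fin K → Fin L → Bool) :
    P.real {ω | (fun k => φ k ω) = fun k => signVec (ε k)} = (((2 : ℝ) ^ L) ^ K)⁻¹ := by
  have h := hφ_indep.measure_inter_preimage_eq_mul Finset.univ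
    (sets := fun p => {if ε p.1 p.2 then 1 else -1}) fun _ _ => measurableSet_singleton _
  have hset : {ω | (fun k => φ k ω) = fun k => signVec (ε k)} =
      ⋂ p ∈ (Finset.univ : Finset (Fin K × Fin L)),
        (fun ω => φ p.1 ω p.2) ⁻¹' {if ε p.1 p.2 then 1 else -1} := by
    ext ω
    simp [funext_iff, signVec]
  rw [measureReal_def, hset, h, Finset.prod_congr rfl fun p _ =>
    measure_eq_of_hasLaw_rademacher (hφ_law p.1 p.2) (ε p.1 p.2)]
  simp [pow_mul, mul_comm K L]

/-- Almost surely `φ` is one of the `2^(LK)` equally likely patterns. Only monotonicity and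
subadditivity are used, so `s` need not be measurable. -/
theorem measureReal_le_of_sign_patterns [IsProbabilityMeasure P]
    (hφ_law : ∀ k l, HasLaw (fun ω => φ k ω l) rademacher P)
    (hφ_indep : iIndepFun (fun (p : Fin K × Fin L) ω => φ p.1 ω p.2) P)
    (B : Finset (Fin K → Fin L → Bool)) (s : Set Ω)
    (hs : ∀ ω ∈ s, ∀ ε : Fin K → Fin L → Bool,
      (fun k => φ k ω) = (fun k => signVec (ε k)) → ε ∈ B) :
    P.real s ≤ B.card * (((2 : ℝ) ^ L) ^ K)⁻¹ := by
  have hsub : s ≤ᵐ[P] ⋃ ε ∈ B, {ω | (fun k => φ k ω) = fun k => signVec (ε k)} := by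
    filter_upwards [ae_exists_eq_signVec hφ_law] with ω ⟨ε, hε⟩ hω
    exact Set.mem_biUnion (hs ω hω ε hε) hε
  calc P.real s ≤ P.real (⋃ ε ∈ B, {ω | (fun k => φ k ω) = fun k => signVec (ε k)}) :=
        ENNReal.toReal_mono (measure_ne_top _ _) (measure_mono_ae hsub)
    _ ≤ ∑ ε ∈ B, P.real {ω | (fun k => φ k ω) = fun k => signVec (ε k)} :=
        measureReal_biUnion_finset_le _ _
    _ = B.card * (((2 : ℝ) ^ L) ^ K)⁻¹ := by
        simp [measure_eq_signVec hφ_law hφ_indep]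

end Probability

/-- The `1` in `β + 1` pays for the dimension factor `L = tr 1` of the Chernoff bound. -/
theorem mul_exp_neg_le_rpow_neg {L : ℕ} (hL : 1 ≤ L) {β t : ℝ} (h : (β + 1) * Real.log L ≤ t) :
    (L : ℝ) * Real.exp (-t) ≤ (L : ℝ) ^ (-β) := by
  have hLpos : (0 : ℝ) < L := by exact_mod_cast hL
  calc (L : ℝ) * Real.exp (-t) ≤ L * Real.exp (-((β + 1) * Real.log L)) := by gcongr
    _ = Real.exp (Real.log L) * Real.exp (-((β + 1) * Real.log L)) := by rw [Real.exp_log hLpos]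
    _ = (L : ℝ) ^ (-β) := by
        rw [← Real.exp_add, Real.rpow_def_of_pos hLpos]
        congr 1
        ring

theorem thetaMin_le_thetaMax {N L : ℕ} (hL : 1 ≤ L) (G : Matrix (Fin N) (Fin L) ℝ) :
    thetaMin G ≤ thetaMax G :=
  (thetaMin_le_colNorm G ⟨0, hL⟩).trans (colNorm_le_thetaMax G _)

theorem condNumber_stacked_probability {Ω : Type*} [MeasurableSpace Ω] {P : Measure Ω}
    [IsProbabilityMeasure P] {N L K : ℕ} (hL : 1 ≤ L) (hK0 : 0 < K)
    {G : Matrix (Fin N) (Fin L) ℝ} (hG : 0 < thetaMin G) {φ : Fin K → Ω → Fin L → ℝ}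
    (hφ_law : ∀ k l, HasLaw (fun ω => φ k ω l) rademacher P)
    (hφ_indep : iIndepFun (fun (p : Fin K × Fin L) ω => φ p.1 ω p.2) P)
    {δ β : ℝ} (hδ : δ ∈ Set.Ioo (0 : ℝ) 1)
    (hK : (β + 1) * Real.log L ≤
      K * thetaMin G ^ 2 / ‖G‖ ^ 2 * ((Real.log 4 - 1) * δ ^ 2)) :
    1 - 2 * (L : ℝ) ^ (-β) ≤
      P.real {ω | condNumber ((stacked G (fun k => φ k ω))ᵀ * stacked G (fun k => φ k ω)) ≤
        ENNReal.ofReal ((1 + δ) * (K * thetaMax G ^ 2) / ((1 - δ) * (K * thetaMin G ^ 2)))} := by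
  classical
  set good := {ω | condNumber ((stacked G (fun k => φ k ω))ᵀ * stacked G (fun k => φ k ω)) ≤
    ENNReal.ofReal ((1 + δ) * (K * thetaMax G ^ 2) / ((1 - δ) * (K * thetaMin G ^ 2)))}
  set upper : Finset (Fin K → Fin L → Bool) := Finset.univ.filter fun ε =>
    ∃ i, (1 + δ) * (K * thetaMax G ^ 2) ≤ (isHermitian_sum_blockGram G ε).eigenvalues i
  set lower : Finset (Fin K → Fin L → Bool) := Finset.univ.filter fun ε =>
    ∃ i, (isHermitian_sum_blockGram G ε).eigenvalues i ≤ (1 - δ) * (K * thetaMin G ^ 2)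
  have hKpos : (0 : ℝ) < K := by exact_mod_cast hK0
  have hδ1 : 0 < 1 - δ := sub_pos.2 hδ.2
  have hδ0 : 0 < δ := hδ.1
  have hbad : P.real goodᶜ ≤ (upper ∪ lower).card * (((2 : ℝ) ^ L) ^ K)⁻¹ := by
    refine measureReal_le_of_sign_patterns hφ_law hφ_indep _ _ fun ω hω ε hε => ?_
    by_contra hnot
    simp only [upper, lower, Finset.mem_union, Finset.mem_filter, Finset.mem_univ, true_and,
      not_or, not_exists, not_le] at hnot
    refine hω ?_
    simp only [good, Set.mem_ofPred_eq]
    rw [hε, stacked_transpose_mul_self]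
    exact condNumber_le_of_eigenvalues (isHermitian_sum_blockGram G ε) (by positivity)
      (by positivity) fun i => ⟨(hnot.2 i).le, (hnot.1 i).le⟩
  have hup := card_sign_patterns_upper hL hG hδ K upper fun ε hε => (Finset.mem_filter.1 hε).2
  have hlow := card_sign_patterns_lower hL hG hδ K lower fun ε hε => (Finset.mem_filter.1 hε).2
  have hc := log_four_sub_one_pos
  -- The upper tail has the rate `θ_max² ≥ θ_min²`, so the lower tail dictates `K`.
  have hK' : (β + 1) * Real.log L ≤
      K * thetaMax G ^ 2 / ‖G‖ ^ 2 * ((Real.log 4 - 1) * δ ^ 2) := by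
    refine hK.trans ?_
    gcongr
    exact thetaMin_le_thetaMax hL G
  have hup' := hup.trans (mul_le_mul_of_nonneg_left (mul_exp_neg_le_rpow_neg hL hK')
    (by positivity))
  have hlow' := hlow.trans (mul_le_mul_of_nonneg_left (mul_exp_neg_le_rpow_neg hL hK)
    (by positivity))
  have hcard : ((upper ∪ lower).card : ℝ) ≤ ((2 : ℝ) ^ L) ^ K * (2 * (L : ℝ) ^ (-β)) := by
    have : ((upper ∪ lower).card : ℝ) ≤ upper.card + lower.card := by
      exact_mod_cast Finset.card_union_le _ _
    linarith
  have hbad' : P.real goodᶜ ≤ 2 * (L : ℝ) ^ (-β) := by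
    refine hbad.trans ?_
    rw [← div_eq_mul_inv, div_le_iff₀ (by positivity)]
    linarith
  -- Subadditivity suffices, so measurability of `good` is not needed.
  have htot : 1 ≤ P.real good + P.real goodᶜ := by
    rw [← probReal_univ (μ := P), ← Set.union_compl_self good]
    exact measureReal_union_le _ _
  linarith

end MaskedImaging

/-! ### The theorem, with the degenerate values of `L` and `δ`. -/

theorem theorem1 {Ω : Type*} [MeasurableSpace Ω] (P : Measure Ω) [IsProbabilityMeasure P]
    (N L K : ℕ) (hL : 1 ≤ L)
    (G : Matrix (Fin N) (Fin L) ℝ) (hG : 0 < MaskedImaging.thetaMin G)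
    (φ : Fin K → Ω → Fin L → ℝ)
    (hφ_law : ∀ k l, HasLaw (fun ω => φ k ω l) MaskedImaging.rademacher P)
    (hφ_indep : iIndepFun (fun (p : Fin K × Fin L) ω => φ p.1 ω p.2) P)
    (δ β : ℝ) (hδ : δ ∈ Set.Icc (0 : ℝ) 1) (hβ : 0 < β)
    (hK : ENNReal.ofReal ((β + 1) / (Real.log 4 - 1)) * (ENNReal.ofReal (δ ^ 2))⁻¹ *
        ENNReal.ofReal (MaskedImaging.rho G ^ 2 / MaskedImaging.thetaMin G ^ 2) *
        ENNReal.ofReal (Real.log L) ≤ (K : ℝ≥0∞)) :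
    1 - 2 * (L : ℝ) ^ (-β) ≤
      P.real {ω |
        MaskedImaging.condNumber
            ((MaskedImaging.stacked G (fun k => φ k ω))ᵀ *
              MaskedImaging.stacked G (fun k => φ k ω)) ≤
          ENNReal.ofReal (1 + δ) / ENNReal.ofReal (1 - δ) *
            ENNReal.ofReal (MaskedImaging.thetaMax G ^ 2 / MaskedImaging.thetaMin G ^ 2)} := by
  open MaskedImaging in
  -- For `L = 1` the claimed probability is at least `1 - 2 < 0`; for `L ≥ 2`, `log L > 0`, which
  -- later forces `K > 0`.
  rcases hL.eq_or_lt with rfl | hL2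
  · refine le_trans ?_ measureReal_nonneg
    simp
  have hlog : 0 < Real.log L := Real.log_pos (by exact_mod_cast hL2)
  have hρ : 0 < rho G := norm_pos_of_thetaMin_pos hL hG
  have hθ : 0 < thetaMax G := hG.trans_le (thetaMin_le_thetaMax hL G)
  have hc := log_four_sub_one_pos
  rcases hδ.2.eq_or_lt with rfl | hδ1
  · have htop : ENNReal.ofReal (1 + 1) / ENNReal.ofReal (1 - 1) *
        ENNReal.ofReal (thetaMax G ^ 2 / thetaMin G ^ 2) = ⊤ := by
      have h1 : ENNReal.ofReal (thetaMax G ^ 2 / thetaMin G ^ 2) ≠ 0 := by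
        rw [Ne, ENNReal.ofReal_eq_zero, not_le]; positivity
      rw [sub_self, ENNReal.ofReal_zero, ENNReal.div_zero (by norm_num), ENNReal.top_mul h1]
    have huniv : {ω | condNumber ((stacked G (fun k => φ k ω))ᵀ * stacked G (fun k => φ k ω)) ≤
        ENNReal.ofReal (1 + 1) / ENNReal.ofReal (1 - 1) *
          ENNReal.ofReal (thetaMax G ^ 2 / thetaMin G ^ 2)} = Set.univ := by
      simp only [htop, le_top, Set.ofPred_true]
    rw [huniv, probReal_univ]
    have : (0 : ℝ) ≤ (L : ℝ) ^ (-β) := by positivity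
    linarith
  rcases hδ.1.eq_or_lt with rfl | hδ0
  -- For `δ = 0` the required lower bound on `K` is infinite, since `log L > 0`.
  · exfalso
    have h1 : ENNReal.ofReal ((β + 1) / (Real.log 4 - 1)) ≠ 0 := by
      rw [Ne, ENNReal.ofReal_eq_zero, not_le]; positivity
    have h2 : ENNReal.ofReal (rho G ^ 2 / thetaMin G ^ 2) ≠ 0 := by
      rw [Ne, ENNReal.ofReal_eq_zero, not_le]; positivity
    have h3 : ENNReal.ofReal (Real.log L) ≠ 0 := by
      rw [Ne, ENNReal.ofReal_eq_zero, not_le]; positivity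
    have h0 : (ENNReal.ofReal ((0 : ℝ) ^ 2))⁻¹ = ⊤ := by simp
    rw [h0, ENNReal.mul_top h1, ENNReal.top_mul h2, ENNReal.top_mul h3] at hK
    exact absurd hK (not_le.2 (ENNReal.natCast_lt_top K))
  rw [← ENNReal.ofReal_inv_of_pos (by positivity), ← ENNReal.ofReal_mul (by positivity),
    ← ENNReal.ofReal_mul (by positivity), ← ENNReal.ofReal_mul (by positivity),
    ← ENNReal.ofReal_natCast, ENNReal.ofReal_le_ofReal_iff (by positivity)] at hK
  have hKpos : (0 : ℝ) < K := lt_of_lt_of_le (by positivity) hK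
  have hK' : (β + 1) * Real.log L ≤
      K * thetaMin G ^ 2 / ‖G‖ ^ 2 * ((Real.log 4 - 1) * δ ^ 2) := by
    have hρ' : 0 < ‖G‖ := hρ
    calc (β + 1) * Real.log L = ((β + 1) / (Real.log 4 - 1) * (δ ^ 2)⁻¹ *
          (rho G ^ 2 / thetaMin G ^ 2) * Real.log L) *
          (thetaMin G ^ 2 / ‖G‖ ^ 2 * ((Real.log 4 - 1) * δ ^ 2)) := by
          rw [rho]; field_simp
      _ ≤ K * (thetaMin G ^ 2 / ‖G‖ ^ 2 * ((Real.log 4 - 1) * δ ^ 2)) := by gcongr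
      _ = _ := by ring
  have hrhs : ENNReal.ofReal (1 + δ) / ENNReal.ofReal (1 - δ) *
      ENNReal.ofReal (thetaMax G ^ 2 / thetaMin G ^ 2) =
      ENNReal.ofReal ((1 + δ) * (K * thetaMax G ^ 2) / ((1 - δ) * (K * thetaMin G ^ 2))) := by
    have hδ1' : 0 < 1 - δ := sub_pos.2 hδ1
    rw [← ENNReal.ofReal_div_of_pos hδ1', ← ENNReal.ofReal_mul (by positivity)]
    congr 1
    field_simp
  rw [hrhs]
  exact condNumber_stacked_probability hL (by exact_mod_cast hKpos) hG hφ_law hφ_indep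
    ⟨hδ0, hδ1⟩ hK'
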